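/- Let $\Bbbk$ be a field, $R=\Bbbk[x_1,\dots,x_n]$, $s\ge 1$, and let $A=(c_{ij}x^{\mathbf a_{ij}})$ be an $s\times l$ matrix over $R$ ($c_{ij}\in\Bbbk$, $\mathbf a_{ij}\in\mathbb N^n$) that is multigraded (every minor is a scalar times a monomial) and squarefree: the system $\gamma_j-\beta_i=\mathbf a_{ij}$ (for all $i,j$ with $c_{ij}\ne0$) has a solution $T=(\gamma_1,\dots,\gamma_l,\beta_1,\dots,\beta_s)$ with all $\gamma_j,\beta_i\in\{0,1\}^n$. Fix such a $T$. Let $F_0=\bigoplus_{i=1}^s Rv_i$ with $\deg v_i=\beta_i$, let $\phi:R^l\to F_0$, $w_j\mapsto\sum_i c_{ij}x^{\mathbf a_{ij}}v_i$, and let $M_A=\operatorname{coker}\phi$, a $\mathbb Z^n$-graded module. Fix a monomial order on $R$, and order the monomials of $F_0$ by: $uv_i>u'v_j$ iff $i>j$, or $i=j$ and $u>u'$. Let $I_i=\{p\in R: pv_i\in \operatorname{in}(\operatorname{im}\phi)\}$ and $\Delta_i=\{\sigma\subseteq[n]:\prod_{t\in\sigma}x_t\notin I_i\}$. Notation. For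 $a\in\mathbb Z^n$ let $\sigma_a=\{c:a_c\neq0\}$; for $L\subseteq[n]$ let $\underline L\in\{0,1\}^n$ be its indicator vector, and let $q_a=\underline{\sigma_a}$. For $t\in L$, $\operatorname{sgn}[t,L]=(-1)^{|\{u\in L:\,u<t\}|}$, and $\operatorname{sgn}[W,L]=\prod_{w\in W}\operatorname{sgn}[w,L]$ for $W\subseteq L$. We write $\tau w$ for $\tau\cup\{w\}$. The coefficients $r_{i,j,a}$. If $a\in\mathbb N^n$ and $\sigma_a\notin\Delta_i$, there are unique $r_{i,j,a}\in\Bbbk$ ($j<i$), with $r_{i,j,a}=0$ unless $a+\beta_i-\beta_j\in\mathbb N^n$ and $\sigma_{a+\beta_i-\beta_j}\in\Delta_j$, such that in $M_A$ $$\overline{x^a v_i}=\sum_{j<i} r_{i,j,a}\,\overline{x^{a+\beta_i-\beta_j}v_j}.$$ The complex. Let $\alpha\in\mathbb Z^n$ and $\alpha_j=\alpha-\beta_j$. Let $\Delta_{j,\alpha}=\{\sigma\subseteq\sigma_{\alpha_j}:\sigma\cup\sigma_{\alpha_j-q_{\alpha_j}}\in\Delta_j\}$ if $\alpha_j\in\mathbb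 N^n$, and let $\Delta_{j,\alpha}$ have no faces at all otherwise. For $r\in\mathbb Z$ let $C^r(j,\alpha)$ be the $\Bbbk$-vector space with basis the $\tau^*$, $\tau\in\Delta_{j,\alpha}$, $|\tau|=r+1$, and let $d_j(\tau^*)=\sum_{t\notin\tau,\ \tau t\in\Delta_{j,\alpha}}\operatorname{sgn}[t,\tau t]\,(\tau t)^*$. For $\rho\subseteq\sigma_{\alpha_j}$ let $f(\rho,j,i)=\sigma_{\alpha_i}\setminus(\sigma_{\alpha_j}\setminus\rho)$. For $\tau\in\Delta_{j,\alpha}$ let $$\chi_j(\tau^*)=\sum_{\substack{w\in\sigma_{\alpha_j}\setminus\tau\\ \tau w\notin\Delta_{j,\alpha}}}\ \sum_{i<j}\operatorname{sgn}[w,\tau w]\; r_{j,i,\,\underline{\tau w}+\alpha_j-q_{\alpha_j}}\;\frac{\operatorname{sgn}[\tau w,\sigma_{\alpha_j}]}{\operatorname{sgn}[f(\tau w,j,i),\sigma_{\alpha_i}]}\;f(\tau w,j,i)^*,$$ where terms with $r_{j,i,\,\underline{\tau w}+\alpha_j-q_{\alpha_j}}=0$ are read as $0$. Let $l_j=|\sigma_{\alpha_j}|-|\sigma_{\alpha_1}|$,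 $C^t(A,\alpha)=\bigoplus_{j=1}^s C^{t+l_j}(j,\alpha)$ for $t\in\mathbb Z$, and let $\delta^t:C^t(A,\alpha)\to C^{t+1}(A,\alpha)$ be given by $\delta^t(\tau^*)=d_j(\tau^*)+\chi_j(\tau^*)$ for $\tau^*\in C^{t+l_j}(j,\alpha)$. Let $K_\bullet$ be the Koszul complex on $x_1,\dots,x_n$: $K_p$ is free on the $e_L$, $L\subseteq[n]$, $|L|=p$, $\deg e_L=\underline L$, with differential $\theta(e_L)=\sum_{t\in L}\operatorname{sgn}[t,L]\,x_t\,e_{L\setminus\{t\}}$. **Theorem.** The coefficients $r_{i,j,a}$ exist and are unique as stated. For every $\alpha\in\mathbb Z^n$, $(C^\bullet(A,\alpha),\delta^\bullet)$ is a cochain complex, i.e. $\delta^{t+1}\delta^t=0$ for all $t$, and it is isomorphic to the $\alpha$-graded piece of $M_A\otimes_R K_\bullet$: there are $\Bbbk$-linear isomorphisms $$C^t(A,\alpha)\;\cong\;(M_A\otimes_R K_{|\sigma_{\alpha_1}|-t-1})_\alpha\qquad(t\in\mathbb Z)$$ that carry $\delta^t$ to the restriction of $1_{M_A}\otimes\theta$.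 -/

import Mathlib

open scoped TensorProduct

noncomputable section

namespace SquarefreeModule

/-! ### Vectors of integers, signs, simplicial complexes -/

/-- The support of an integer vector. -/
def supp {n : ℕ} (a : Fin n → ℤ) : Finset (Fin n) :=
  Finset.univ.filter fun c => a c ≠ 0

theorem mem_supp {n : ℕ} {a : Fin n → ℤ} {c : Fin n} : c ∈ supp a ↔ a c ≠ 0 := by
  simp [supp]

/-- The 0/1 indicator vector of a subset of the index set.
In particular `ind (supp a)` is the squarefree vector with the same support as `a`. -/
def ind {n : ℕ} (L : Finset (Fin n)) : Fin n → ℤ :=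
  fun c => if c ∈ L then 1 else 0

/-- An integer vector is squarefree if its entries lie in `{0, 1}`. -/
def IsSquarefreeVec {n : ℕ} (a : Fin n → ℤ) : Prop :=
  ∀ c, a c = 0 ∨ a c = 1

/-- The sign `(-1)^(r+1)` of the `r`-th smallest element `t` of `L`: the exponent is the number
of elements of `L` that are smaller than `t`. -/
def sgn {n : ℕ} (t : Fin n) (L : Finset (Fin n)) : ℤ :=
  (-1) ^ (L.filter fun u => u < t).card

/-- The sign of a subset `W` of `L`, the product of the signs of its elements. -/
def sgnSet {n : ℕ} (W L : Finset (Fin n)) : ℤ :=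
  ∏ w ∈ W, sgn w L

/-- A (possibly void) simplicial complex with faces in `Fin n`: a family of finite sets closed
under taking subsets. The empty set may be a face. -/
structure FaceComplex (n : ℕ) where
  faces : Set (Finset (Fin n))
  down_closed : ∀ {σ τ : Finset (Fin n)}, σ ∈ faces → τ ⊆ σ → τ ∈ faces

/-- The complex of an ideal `I`: those `σ` for which the product of the `x_t`, `t ∈ σ`, is not
in `I`. -/
def FaceComplex.ofIdeal {k : Type*} [Field k] {n : ℕ} (I : Ideal (MvPolynomial (Fin n) k)) :
    FaceComplex n where
  faces := {σ | (∏ t ∈ σ, MvPolynomial.X t : MvPolynomial (Fin n) k) ∉ I}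
  down_closed := by
    intro σ τ hσ hτ h
    apply hσ
    rw [← Finset.prod_sdiff hτ]
    exact I.mul_mem_left _ h

/-- The complex `Δ_a`: for `a ≥ 0` the sets `σ ⊆ supp a` with `σ ∪ supp (a - q_a) ∈ Δ`, where
`q_a = ind (supp a)`; the void complex if `a` has a negative entry. -/
def FaceComplex.atDegree {n : ℕ} (Δ : FaceComplex n) (a : Fin n → ℤ) : FaceComplex n where
  faces := {σ | 0 ≤ a ∧ σ ⊆ supp a ∧ σ ∪ supp (a - ind (supp a)) ∈ Δ.faces}
  down_closed := by
    rintro σ τ ⟨h0, h1, h2⟩ hτ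
    exact ⟨h0, hτ.trans h1, Δ.down_closed h2 (Finset.union_subset_union_left hτ)⟩

/-- The space `C^j(Δ)` with basis the faces of cardinality `j + 1`, for every integer `j`. -/
abbrev Cochain (k : Type*) [Field k] {n : ℕ} (Δ : FaceComplex n) (j : ℤ) : Type _ :=
  {τ : Finset (Fin n) // τ ∈ Δ.faces ∧ (τ.card : ℤ) = j + 1} →₀ k

open Classical in
/-- The basis vector `τ^*` of `C^j(Δ)` if `τ` is a face of cardinality `j + 1`, and zero
otherwise. -/
def star (k : Type*) [Field k] {n : ℕ} (Δ : FaceComplex n) (j : ℤ) (τ : Finset (Fin n)) :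
    Cochain k Δ j :=
  if h : τ ∈ Δ.faces ∧ (τ.card : ℤ) = j + 1 then Finsupp.single ⟨τ, h⟩ 1 else 0

open Classical in
/-- The simplicial coboundary `C^j(Δ) → C^{j'}(Δ)`, `τ^* ↦ ∑ sgn[t, τ t] (τ t)^*`, the sum over
the `t ∉ τ` with `τ t ∈ Δ`. It is meant for `j' = j + 1` (and is zero for any other `j'`). -/
def coboundary (k : Type*) [Field k] {n : ℕ} (Δ : FaceComplex n) (j j' : ℤ) :
    Cochain k Δ j →ₗ[k] Cochain k Δ j' :=
  Finsupp.linearCombination k fun τ =>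
    ∑ t ∈ Finset.univ.filter (fun t => t ∉ τ.1 ∧ insert t τ.1 ∈ Δ.faces),
      ((sgn t (insert t τ.1) : ℤ) : k) • star k Δ j' (insert t τ.1)

/-! ### Polynomials and the Koszul complex with their multigrading -/

/-- The monomial `x^a` if `a ≥ 0`, and zero if `a` has a negative entry. -/
def mono (k : Type*) [Field k] {n : ℕ} (a : Fin n → ℤ) : MvPolynomial (Fin n) k :=
  open Classical in
  if 0 ≤ a then
    MvPolynomial.monomial (Finsupp.equivFunOnFinite.symm fun c => (a c).toNat) 1
  else 0

/-- The piece of degree `a` of the polynomial ring (zero if `a` has a negative entry). -/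
def polyPiece (k : Type*) [Field k] {n : ℕ} (a : Fin n → ℤ) :
    Submodule k (MvPolynomial (Fin n) k) :=
  MvPolynomial.restrictSupport k {b : Fin n →₀ ℕ | ∀ c, (b c : ℤ) = a c}

/-- The term `K_j` of the Koszul complex on `x_1, …, x_n`: the free module with basis the `e_L`,
`L` of cardinality `j`, for every integer `j`. -/
abbrev Koszul (k : Type*) [Field k] (n : ℕ) (j : ℤ) : Type _ :=
  {L : Finset (Fin n) // (L.card : ℤ) = j} →₀ MvPolynomial (Fin n) k

open Classical in
/-- The basis vector `e_L` of `K_j` if `L` has cardinality `j`, and zero otherwise. -/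
def koszulBasis (k : Type*) [Field k] {n : ℕ} (j : ℤ) (L : Finset (Fin n)) : Koszul k n j :=
  if h : (L.card : ℤ) = j then Finsupp.single ⟨L, h⟩ 1 else 0

/-- The Koszul differential `K_j → K_{j'}`, `e_L ↦ ∑_{t ∈ L} sgn[t, L] x_t e_{L \ t}`. It is meant
for `j' = j - 1` (and is zero for any other `j'`). -/
def koszulDiff (k : Type*) [Field k] (n : ℕ) (j j' : ℤ) :
    Koszul k n j →ₗ[MvPolynomial (Fin n) k] Koszul k n j' :=
  Finsupp.linearCombination (MvPolynomial (Fin n) k) fun L =>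
    ∑ t ∈ L.1, ((sgn t L.1 : ℤ) : MvPolynomial (Fin n) k) •
      (MvPolynomial.X t : MvPolynomial (Fin n) k) • koszulBasis k j' (L.1.erase t)

/-- The piece of degree `a` of `K_j`, where `e_L` has degree `ind L`. -/
def koszulPiece (k : Type*) [Field k] {n : ℕ} (j : ℤ) (a : Fin n → ℤ) :
    Submodule k (Koszul k n j) :=
  ⨅ L : {L : Finset (Fin n) // (L.card : ℤ) = j},
    (polyPiece k (a - ind L.1)).comap
      ((Finsupp.lapply L : Koszul k n j →ₗ[MvPolynomial (Fin n) k] _).restrictScalars k)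

/-! ### Initial modules -/

/-- The initial module of `N ⊆ R^s` for the term order `u v_i > u' v_j` iff `i > j`, or `i = j` and
`u > u'` in the monomial order `m`. The leading term of a nonzero `f` is that of its last nonzero
component. -/
def initialModule {k : Type*} [Field k] {n s : ℕ} (m : MonomialOrder (Fin n))
    (N : Submodule (MvPolynomial (Fin n) k) (Fin s → MvPolynomial (Fin n) k)) :
    Submodule (MvPolynomial (Fin n) k) (Fin s → MvPolynomial (Fin n) k) :=
  Submodule.span _ {g | ∃ f ∈ N, ∃ i, f i ≠ 0 ∧ (∀ j, i < j → f j = 0) ∧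
    g = Pi.single i (m.leadingTerm (f i))}

/-- The ideal `I_i` of all `p` with `p v_i` in the initial module of `N`. -/
def initialIdeal {k : Type*} [Field k] {n s : ℕ} (m : MonomialOrder (Fin n))
    (N : Submodule (MvPolynomial (Fin n) k) (Fin s → MvPolynomial (Fin n) k)) (i : Fin s) :
    Ideal (MvPolynomial (Fin n) k) :=
  (initialModule m N).comap
    (LinearMap.single (MvPolynomial (Fin n) k) (fun _ : Fin s => MvPolynomial (Fin n) k) i)

/-! ### Squarefree multigraded matrices and their cokernels -/

/-- An `s × l` matrix with entries `c_ij x^(a_ij)`. -/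
structure MonomialMatrix (k : Type*) [Field k] (n s l : ℕ) where
  coeff : Fin s → Fin l → k
  expo : Fin s → Fin l → Fin n →₀ ℕ

namespace MonomialMatrix

variable {k : Type*} [Field k] {n s l : ℕ} (A : MonomialMatrix k n s l)

def toMatrix : Matrix (Fin s) (Fin l) (MvPolynomial (Fin n) k) :=
  Matrix.of fun i j => MvPolynomial.monomial (A.expo i j) (A.coeff i j)

/-- Every minor is a scalar multiple of a monomial. -/
def IsMultigraded : Prop :=
  ∀ (p : ℕ) (I : Fin p ↪o Fin s) (J : Fin p ↪o Fin l), ∃ (a : Fin n →₀ ℕ) (c : k),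
    (A.toMatrix.submatrix I J).det = MvPolynomial.monomial a c

/-- A squarefree solution of the system `γ_j - β_i = a_ij` (for all `i, j` with `c_ij ≠ 0`). -/
structure SquarefreeSolution where
  γ : Fin l → Fin n → ℤ
  β : Fin s → Fin n → ℤ
  eqn : ∀ i j, A.coeff i j ≠ 0 → ∀ c, γ j c - β i c = A.expo i j c
  γ_squarefree : ∀ j, IsSquarefreeVec (γ j)
  β_squarefree : ∀ i, IsSquarefreeVec (β i)

/-- A multigraded matrix is squarefree if its system of equations has a squarefree solution. -/
def IsSquarefree : Prop :=
  A.IsMultigraded ∧ Nonempty A.SquarefreeSolution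

/-- The image of `φ : R^l → R^s`, `w_j ↦ ∑_i c_ij x^(a_ij) v_i`. -/
def relations : Submodule (MvPolynomial (Fin n) k) (Fin s → MvPolynomial (Fin n) k) :=
  LinearMap.range A.toMatrix.mulVecLin

/-- The module `M_A = coker φ`. -/
abbrev Mod : Type _ :=
  (Fin s → MvPolynomial (Fin n) k) ⧸ A.relations

/-- The class of `p v_i` in `M_A`. -/
def cls (i : Fin s) (p : MvPolynomial (Fin n) k) : A.Mod :=
  A.relations.mkQ (Pi.single i p)

namespace SquarefreeSolution

variable {A} (T : A.SquarefreeSolution)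

/-- The piece of degree `a` of `M_A`, the image of the piece of degree `a` of `R^s`, where `v_i` has
degree `β_i`. -/
def modPiece (a : Fin n → ℤ) : Submodule k A.Mod :=
  (Submodule.pi Set.univ fun i => polyPiece k (a - T.β i)).map
    (A.relations.mkQ.restrictScalars k)

/-- The piece of degree `α` of `M_A ⊗_R K_j`: the `k`-span of the `y ⊗ z` with `y`, `z` homogeneous
of degrees that add up to `α`. -/
def tensorPiece (α : Fin n → ℤ) (j : ℤ) :
    Submodule k (A.Mod ⊗[MvPolynomial (Fin n) k] Koszul k n j) :=
  Submodule.span k {u | ∃ a b : Fin n → ℤ, a + b = α ∧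
    ∃ y ∈ T.modPiece a, ∃ z ∈ koszulPiece k j b, u = y ⊗ₜ[MvPolynomial (Fin n) k] z}

/-- The vector `α_j = α - β_j`. -/
def shift (α : Fin n → ℤ) (j : Fin s) : Fin n → ℤ :=
  α - T.β j

end SquarefreeSolution

/-- The complex `Δ_i` of the ideal `I_i`. -/
def cplx (m : MonomialOrder (Fin n)) (i : Fin s) : FaceComplex n :=
  FaceComplex.ofIdeal (initialIdeal m A.relations i)

namespace SquarefreeSolution

variable {A} (T : A.SquarefreeSolution)

/-- `c = (c_j)` gives the expansion of the class of `x^a v_i` in the classes of those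
`x^(a + β_i - β_j) v_j`, `j < i`, whose exponent is nonnegative with support in `Δ_j`. -/
def IsExpansion (m : MonomialOrder (Fin n)) (i : Fin s) (a : Fin n → ℤ) (c : Fin s → k) : Prop :=
  (∀ j, c j ≠ 0 →
    j < i ∧ 0 ≤ a + T.β i - T.β j ∧ supp (a + T.β i - T.β j) ∈ (A.cplx m j).faces) ∧
  A.cls i (mono k a) =
    ∑ j ∈ Finset.univ.filter (fun j => j < i), c j • A.cls j (mono k (a + T.β i - T.β j))

open Classical in
/-- The coefficients `r_{i,j,a}`. -/
def r (m : MonomialOrder (Fin n)) (i j : Fin s) (a : Fin n → ℤ) : k :=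
  if h : ∃ c, T.IsExpansion m i a c then h.choose j else 0

/-- The complex `Δ_{j,α}`. -/
def cplxAt (m : MonomialOrder (Fin n)) (α : Fin n → ℤ) (j : Fin s) : FaceComplex n :=
  (A.cplx m j).atDegree (T.shift α j)

/-- The set `f(ρ, j, i)`, for `ρ ⊆ supp α_j`: the complement in `supp α_i` of the complement of `ρ`
in `supp α_j`. -/
def transfer (α : Fin n → ℤ) (ρ : Finset (Fin n)) (j i : Fin s) : Finset (Fin n) :=
  supp (T.shift α i) \ (supp (T.shift α j) \ ρ)

/-- For `α` with entries at most `1`, the set `f(ρ, j, i)` is `(supp β_j ∪ ρ) \ supp β_i`. -/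
theorem transfer_eq_of_le_one (α : Fin n → ℤ) (hα : ∀ c, α c ≤ 1) (ρ : Finset (Fin n)) (j i : Fin s)
    (hj : 0 ≤ T.shift α j) (hi : 0 ≤ T.shift α i) (hρ : ρ ⊆ supp (T.shift α j)) :
    T.transfer α ρ j i = (supp (T.β j) ∪ ρ) \ supp (T.β i) := by
  ext c
  have h1 := hα c
  have h2 := hj c
  have h3 := hi c
  have h4 := T.β_squarefree j c
  have h5 := T.β_squarefree i c
  have h6 := @hρ c
  simp only [transfer, shift, mem_supp, Pi.sub_apply, Pi.zero_apply, Finset.mem_sdiff,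
    Finset.mem_union] at *
  have h7 : α c = 0 ∨ α c = 1 := by omega
  by_cases hc : c ∈ ρ <;> rcases h4 with h4 | h4 <;> rcases h5 with h5 | h5 <;>
    rcases h7 with h7 | h7 <;> simp_all

/-- The integer `l_j = |supp α_j| - |supp α_1|`. -/
def offset [NeZero s] (α : Fin n → ℤ) (j : Fin s) : ℤ :=
  ((supp (T.shift α j)).card : ℤ) - ((supp (T.shift α 0)).card : ℤ)

/-- The space `C^t(A,α) = ⊕_j C^{t + l_j}(Δ_{j,α})`. -/
abbrev Glued [NeZero s] (m : MonomialOrder (Fin n)) (α : Fin n → ℤ) (t : ℤ) : Type _ :=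
  (j : Fin s) → Cochain k (T.cplxAt m α j) (t + T.offset α j)

open Classical in
/-- The map `χ_j : C^{t + l_j}(Δ_{j,α}) → ⊕_{i < j} C^{t + 1 + l_i}(Δ_{i,α})`. The sum is over the
vertices `w ∈ supp α_j`, `w ∉ τ`, for which `τ w` is not a face of `Δ_{j,α}`. -/
def chi [NeZero s] (m : MonomialOrder (Fin n)) (α : Fin n → ℤ) (t : ℤ) (j : Fin s) :
    Cochain k (T.cplxAt m α j) (t + T.offset α j) →ₗ[k] T.Glued m α (t + 1) :=
  Finsupp.linearCombination k fun τ =>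
    ∑ w ∈ (supp (T.shift α j) \ τ.1).filter (fun w => insert w τ.1 ∉ (T.cplxAt m α j).faces),
      ∑ i ∈ Finset.univ.filter (fun i => i < j),
        (((sgn w (insert w τ.1) : ℤ) : k) *
          T.r m j i (ind (insert w τ.1) + T.shift α j - ind (supp (T.shift α j))) *
          (((sgnSet (insert w τ.1) (supp (T.shift α j)) : ℤ) : k) /
            ((sgnSet (T.transfer α (insert w τ.1) j i) (supp (T.shift α i)) : ℤ) : k))) •
        (Pi.single i (star k (T.cplxAt m α i) (t + 1 + T.offset α i)
          (T.transfer α (insert w τ.1) j i)) : T.Glued m α (t + 1))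

/-- The map `δ^t : C^t(A,α) → C^{t+1}(A,α)`, `τ^* ↦ d_j(τ^*) + χ_j(τ^*)` for `τ ∈ Δ_{j,α}`. -/
def delta [NeZero s] (m : MonomialOrder (Fin n)) (α : Fin n → ℤ) (t : ℤ) :
    T.Glued m α t →ₗ[k] T.Glued m α (t + 1) :=
  ∑ j : Fin s,
    (LinearMap.single k (fun i => Cochain k (T.cplxAt m α i) (t + 1 + T.offset α i)) j ∘ₗ
        coboundary k (T.cplxAt m α j) (t + T.offset α j) (t + 1 + T.offset α j) +
      T.chi m α t j) ∘ₗ LinearMap.proj j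

end SquarefreeSolution

end MonomialMatrix

end SquarefreeModule

end

open SquarefreeModule

/-!
In degree `a` the relations of `M_A` are a subspace of `k^s` (a vector `v` standing for
`∑ v_i x^(a - β_i) v_i`), namely the span `colSpan a` of the columns of coefficients whose degree
`γ_j` is at most `a` (`mem_relations_of_mem_colSpan`, `intCoeff_mem_colSpan`). Because the `γ_j` and
`β_i` are 0/1 vectors, this subspace depends only on the support of `a` once `a ≥ β_i`
(`colSpan_ind_supp`). For the chosen order, `x^b v_i` lies in the initial module exactly when some
vector of `colSpan (b + β_i)` has its last nonzero entry in position `i`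
(`mono_mem_initialIdeal_iff`); so `supp b ∈ Δ_i` says that `i` is not such a pivot
(`supp_mem_cplx_iff`). By linear algebra, the standard monomials `x^(a - β_j) v_j` with
`supp (a - β_j) ∈ Δ_j` give a basis of `(M_A)_a` (`eq_of_classMap_eq`,
`exists_standard_expansion`), and a pivot monomial expands in standard ones with smaller index. This
gives the coefficients `r_{i,j,a}` and their uniqueness.

The piece of degree `α` of `M_A ⊗ K_p` is the direct sum over the `L` of cardinality `p` of
`(M_A)_(α - ind L) ⊗ e_L`. Its standard monomials in position `j` correspond to the faces
`τ = supp α_j \ L` of `Δ_{j,α}` (`isStandard_sub_ind_iff`), so that the map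
`τ^* ↦ sgn[τ, supp α_j] x^(α_j - ind L) v_j ⊗ e_L` is an isomorphism onto this piece
(`range_comparison`, `comparison_injective`). Applying `1 ⊗ θ` removes an element `w` from `L`, that
is, adds it to `τ`. If `τ w` is a face, the result is a standard monomial and contributes to `d_j`;
otherwise it is replaced by its expansion and contributes to `χ_j` (`tensorMono_eq_sum`,
`comparison_delta`). Finally `δδ = 0` follows from `θθ = 0` and injectivity.
-/

noncomputable section

namespace SquarefreeModule

/-! ### Monomials with integer exponent vectors -/

/-- The exponent vector of `x^a`, for an integer vector `a`; negative entries are truncated to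
zero. -/
def natExp {n : ℕ} (a : Fin n → ℤ) : Fin n →₀ ℕ :=
  Finsupp.equivFunOnFinite.symm fun c => (a c).toNat

@[simp]
theorem natExp_apply {n : ℕ} (a : Fin n → ℤ) (c : Fin n) : natExp a c = (a c).toNat := rfl

theorem natExp_natCast {n : ℕ} (b : Fin n →₀ ℕ) : natExp (fun c => (b c : ℤ)) = b := by
  ext c; simp

section Monomials

variable {k : Type*} [Field k] {n : ℕ}

theorem mono_of_nonneg {a : Fin n → ℤ} (h : 0 ≤ a) :
    mono k a = MvPolynomial.monomial (natExp a) 1 := by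
  simp [mono, h, natExp]

theorem mono_of_not_nonneg {a : Fin n → ℤ} (h : ¬ 0 ≤ a) : mono k a = 0 := by
  simp [mono, h]

theorem mono_mul_mono {a b : Fin n → ℤ} (ha : 0 ≤ a) (hb : 0 ≤ b) :
    mono k a * mono k b = mono k (a + b) := by
  rw [mono_of_nonneg ha, mono_of_nonneg hb, mono_of_nonneg (add_nonneg ha hb),
    MvPolynomial.monomial_mul, one_mul]
  refine congrArg (fun e => MvPolynomial.monomial e (1 : k)) (Finsupp.ext fun c => ?_)
  simp [Int.toNat_add (ha c) (hb c)]

theorem ind_nonneg (L : Finset (Fin n)) : 0 ≤ ind L := by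
  intro c
  simp only [ind, Pi.zero_apply]
  split_ifs <;> simp

theorem X_eq_mono (t : Fin n) : (MvPolynomial.X t : MvPolynomial (Fin n) k) = mono k (ind {t}) := by
  rw [mono_of_nonneg (ind_nonneg _), MvPolynomial.X]
  refine congrArg (fun e => MvPolynomial.monomial e (1 : k)) (Finsupp.ext fun c => ?_)
  by_cases h : c = t
  · subst h; simp [ind]
  · simp [ind, h]

theorem mono_zero : mono k (0 : Fin n → ℤ) = 1 := by
  rw [mono_of_nonneg le_rfl, ← MvPolynomial.C_1, MvPolynomial.C_apply]
  exact congrArg (fun e => MvPolynomial.monomial e (1 : k)) (Finsupp.ext fun c => by simp)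

theorem prod_X_eq_mono (σ : Finset (Fin n)) :
    (∏ t ∈ σ, MvPolynomial.X t : MvPolynomial (Fin n) k) = mono k (ind σ) := by
  induction σ using Finset.induction_on with
  | empty =>
    rw [Finset.prod_empty, ← mono_zero]
    congr 1
  | insert t σ ht ih =>
    rw [Finset.prod_insert ht, ih, X_eq_mono, mono_mul_mono (ind_nonneg _) (ind_nonneg _)]
    congr 1
    funext c
    by_cases h : c = t
    · subst h; simp [ind, ht]
    · simp [ind, h]

theorem mem_polyPiece_iff {a : Fin n → ℤ} {p : MvPolynomial (Fin n) k} :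
    p ∈ polyPiece k a ↔ ∃ c : k, p = c • mono k a := by
  rw [polyPiece, MvPolynomial.mem_restrictSupport_iff]
  constructor
  · intro h
    by_cases ha : 0 ≤ a
    · refine ⟨p.coeff (natExp a), ?_⟩
      rw [mono_of_nonneg ha]
      ext b
      rw [MvPolynomial.coeff_smul, MvPolynomial.coeff_monomial]
      split_ifs with hb
      · rw [hb]; simp
      · rw [smul_zero]
        by_contra hp
        have := h (MvPolynomial.mem_support_iff.2 hp)
        apply hb
        ext c
        have := this c
        simp only [natExp_apply]
        omega
    · refine ⟨0, ?_⟩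
      rw [zero_smul]
      ext b
      by_contra hp
      have := h (MvPolynomial.mem_support_iff.2 hp)
      exact ha fun c => by
        have := this c
        simp only [Pi.zero_apply]
        omega
  · rintro ⟨c, rfl⟩ b hb
    by_cases ha : 0 ≤ a
    · rw [mono_of_nonneg ha] at hb
      simp only [Finset.mem_coe, MvPolynomial.mem_support_iff, MvPolynomial.coeff_smul,
        MvPolynomial.coeff_monomial] at hb
      intro d
      have : natExp a = b := by
        by_contra h
        simp [h] at hb
      rw [← this]
      have := ha d
      simp only [natExp_apply]
      simpa using this
    · simp [mono_of_not_nonneg ha] at hb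

/-- The coefficient of `x^a` as a linear functional, zero if `a` has a negative entry. -/
def intCoeff (k : Type*) [Field k] {n : ℕ} (a : Fin n → ℤ) : MvPolynomial (Fin n) k →ₗ[k] k :=
  open Classical in if 0 ≤ a then MvPolynomial.lcoeff k (natExp a) else 0

theorem intCoeff_of_nonneg {a : Fin n → ℤ} (h : 0 ≤ a) (p : MvPolynomial (Fin n) k) :
    intCoeff k a p = p.coeff (natExp a) := by
  simp [intCoeff, h]

theorem intCoeff_of_not_nonneg {a : Fin n → ℤ} (h : ¬ 0 ≤ a) (p : MvPolynomial (Fin n) k) :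
    intCoeff k a p = 0 := by
  simp [intCoeff, h]

theorem intCoeff_mono {a : Fin n → ℤ} (h : 0 ≤ a) : intCoeff k a (mono k a) = 1 := by
  rw [intCoeff_of_nonneg h, mono_of_nonneg h, MvPolynomial.coeff_monomial, if_pos rfl]

theorem intCoeff_monomial_mul (a : Fin n → ℤ) (e : Fin n →₀ ℕ) (c : k)
    (p : MvPolynomial (Fin n) k) :
    intCoeff k a (MvPolynomial.monomial e c * p) =
      c * intCoeff k (a - fun d => (e d : ℤ)) p := by
  by_cases ha : 0 ≤ a
  · rw [intCoeff_of_nonneg ha, MvPolynomial.coeff_monomial_mul']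
    by_cases he : 0 ≤ a - fun d => (e d : ℤ)
    · rw [intCoeff_of_nonneg he, if_pos]
      · congr 2
        ext d
        have := he d
        simp only [Pi.zero_apply, Pi.sub_apply] at this
        simp only [Finsupp.tsub_apply, natExp_apply, Pi.sub_apply]
        omega
      · intro d
        have := he d
        simp only [Pi.zero_apply, Pi.sub_apply] at this
        simp only [natExp_apply]
        omega
    · rw [intCoeff_of_not_nonneg he, if_neg, mul_zero]
      intro hle
      apply he
      intro d
      have := hle d
      have h0 := ha d
      simp only [natExp_apply, Pi.zero_apply] at this h0
      simp only [Pi.zero_apply, Pi.sub_apply]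
      omega
  · rw [intCoeff_of_not_nonneg ha, intCoeff_of_not_nonneg, mul_zero]
    intro h
    apply ha
    intro d
    have := h d
    simp only [Pi.zero_apply, Pi.sub_apply] at this ⊢
    omega

end Monomials

/-! ### Leading positions in a subspace of a coordinate space -/

section Pivots

variable {k : Type*} [Field k] {s : ℕ}

/-- The position `i` is a pivot of `V ⊆ k^s` if some vector of `V` has its last nonzero entry in
position `i`. -/
def IsPivot (V : Submodule k (Fin s → k)) (i : Fin s) : Prop :=
  ∃ v ∈ V, v i ≠ 0 ∧ ∀ j, i < j → v j = 0

theorem eq_zero_of_forall_not_isPivot {V : Submodule k (Fin s → k)} {v : Fin s → k} (hv : v ∈ V)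
    (h : ∀ j, v j ≠ 0 → ¬ IsPivot V j) : v = 0 := by
  classical
  by_contra hne
  have hex : (Finset.univ.filter fun j => v j ≠ 0).Nonempty := by
    by_contra hemp
    rw [Finset.not_nonempty_iff_eq_empty] at hemp
    apply hne
    funext j
    by_contra hj
    have : j ∈ (Finset.univ.filter fun j => v j ≠ 0) := by simpa using hj
    simp [hemp] at this
  have hmem := Finset.max'_mem _ hex
  simp only [Finset.mem_filter, Finset.mem_univ, true_and] at hmem
  refine h _ hmem ⟨v, hv, hmem, fun j hj => ?_⟩
  by_contra hjv
  exact absurd (Finset.le_max' _ j (by simpa using hjv)) (not_le.2 hj)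

/-- Reduction modulo `V`: a standard basis vector is congruent to a combination of the basis
vectors in non-pivot positions that are not larger. If the vectors of `V` are supported on `Q`, the
combination stays inside `Q`. -/
theorem exists_reduction (V : Submodule k (Fin s → k)) (Q : Fin s → Prop)
    (hQ : ∀ v ∈ V, ∀ j, v j ≠ 0 → Q j) (i : Fin s) (hi : Q i) :
    ∃ c : Fin s → k, Pi.single i 1 - c ∈ V ∧
      ∀ j, c j ≠ 0 → j ≤ i ∧ ¬ IsPivot V j ∧ Q j := by
  induction i using WellFoundedLT.induction with
  | ind i ih =>
  by_cases hp : IsPivot V i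
  · obtain ⟨v, hv, hvi, hvj⟩ := hp
    -- For `v` scaled to have entry `1` at `i`, `e_i` is congruent to `-∑_{j < i} v_j e_j`.
    have ih' : ∀ j, ∃ c : Fin s → k, (j < i → v j ≠ 0 → Pi.single j 1 - c ∈ V) ∧
        ∀ d, c d ≠ 0 → d ≤ i ∧ ¬ IsPivot V d ∧ Q d := by
      intro j
      by_cases h : j < i ∧ v j ≠ 0
      · obtain ⟨c, h1, h2⟩ := ih j h.1 (hQ v hv j h.2)
        exact ⟨c, fun _ _ => h1, fun d hd => ⟨(h2 d hd).1.trans h.1.le, (h2 d hd).2⟩⟩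
      · exact ⟨0, fun h1 h2 => absurd ⟨h1, h2⟩ h, fun d hd => absurd rfl hd⟩
    choose c hc1 hc2 using ih'
    refine ⟨-∑ j ∈ Finset.univ.filter (fun j => j < i), ((v i)⁻¹ * v j) • c j, ?_, ?_⟩
    · have hdec : (Pi.single i 1 : Fin s → k) = (v i)⁻¹ • v -
          ∑ j ∈ Finset.univ.filter (fun j => j < i), ((v i)⁻¹ * v j) • Pi.single j 1 := by
        funext d
        simp only [Pi.sub_apply, Pi.smul_apply, Finset.sum_apply, smul_eq_mul, Pi.single_apply,
          mul_ite, mul_one, mul_zero, Finset.sum_ite_eq, Finset.mem_filter, Finset.mem_univ,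
          true_and]
        rcases lt_trichotomy d i with h | h | h
        · simp [h, h.ne]
        · subst h; simp [hvi]
        · simp [hvj d h, h.ne', not_lt.2 h.le]
      rw [hdec, sub_neg_eq_add, sub_add, ← Finset.sum_sub_distrib]
      refine V.sub_mem (V.smul_mem _ hv) (V.sum_mem fun j hj => ?_)
      rw [← smul_sub]
      by_cases hvj0 : v j = 0
      · simp [hvj0]
      · exact V.smul_mem _ (hc1 j (by simpa using hj) hvj0)
    · intro d hd
      rw [Pi.neg_apply, neg_ne_zero, Finset.sum_apply] at hd
      obtain ⟨j, -, hj⟩ := Finset.exists_ne_zero_of_sum_ne_zero hd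
      exact hc2 j d (right_ne_zero_of_mul hj)
  · refine ⟨Pi.single i 1, by simp, fun j hj => ?_⟩
    have : j = i := by
      by_contra h
      simp [h] at hj
    subst this
    exact ⟨le_rfl, hp, hi⟩

end Pivots

namespace MonomialMatrix

namespace SquarefreeSolution

variable {k : Type*} [Field k] {n s l : ℕ} {A : MonomialMatrix k n s l} (T : A.SquarefreeSolution)

/-! ### The relations in a fixed degree -/

/-- The relations of degree `a`, as a subspace of `k^s`: the vector `v` stands for
`∑ v_i x^(a - β_i) v_i`. It is spanned by the columns of coefficients of degree `γ_j ≤ a`. -/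
def colSpan (a : Fin n → ℤ) : Submodule k (Fin s → k) :=
  Submodule.span k {v | ∃ j, T.γ j ≤ a ∧ v = fun i => A.coeff i j}

theorem β_le_γ {i : Fin s} {j : Fin l} (h : A.coeff i j ≠ 0) : T.β i ≤ T.γ j := by
  intro c
  have := T.eqn i j h c
  change T.β i c ≤ T.γ j c
  omega

theorem colSpan_mono {a b : Fin n → ℤ} (h : a ≤ b) : T.colSpan a ≤ T.colSpan b := by
  apply Submodule.span_mono
  rintro v ⟨j, hj, rfl⟩
  exact ⟨j, hj.trans h, rfl⟩

theorem β_le_of_mem_colSpan {a : Fin n → ℤ} {v : Fin s → k} (hv : v ∈ T.colSpan a) {i : Fin s}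
    (hi : v i ≠ 0) : T.β i ≤ a := by
  by_contra hle
  apply hi
  have : T.colSpan a ≤ LinearMap.ker (LinearMap.proj (R := k) (φ := fun _ : Fin s => k) i) := by
    refine Submodule.span_le.2 ?_
    rintro w ⟨j, hj, rfl⟩
    simp only [SetLike.mem_coe, LinearMap.mem_ker, LinearMap.proj_apply]
    by_contra hc
    exact hle ((T.β_le_γ hc).trans hj)
  simpa using this hv

/-- Squarefreeness: the relations in a degree above `β_i` depend on its support only. -/
theorem colSpan_ind_supp {b : Fin n → ℤ} (hb : 0 ≤ b) (i : Fin s) :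
    T.colSpan (ind (supp b) + T.β i) = T.colSpan (b + T.β i) := by
  -- For `γ, β ∈ {0, 1}` and `b ≥ 0`, `γ ≤ b + β` is equivalent to `γ ≤ min(b, 1) + β`.
  have key : ∀ j, T.γ j ≤ ind (supp b) + T.β i ↔ T.γ j ≤ b + T.β i := by
    intro j
    refine forall_congr' fun c => ?_
    have h1 := T.γ_squarefree j c
    have h2 := T.β_squarefree i c
    have h3 := hb c
    simp only [Pi.add_apply, ind, mem_supp, Pi.zero_apply] at *
    split_ifs with h <;> omega
  simp only [colSpan, key]

theorem mem_relations_of_mem_colSpan {a : Fin n → ℤ} {v : Fin s → k} (hv : v ∈ T.colSpan a) :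
    (fun i => v i • mono k (a - T.β i)) ∈ A.relations := by
  let F : (Fin s → k) →ₗ[k] (Fin s → MvPolynomial (Fin n) k) :=
    LinearMap.pi fun i => (LinearMap.toSpanSingleton k _ (mono k (a - T.β i))) ∘ₗ LinearMap.proj i
  suffices T.colSpan a ≤ (A.relations.restrictScalars k).comap F from this hv
  refine Submodule.span_le.2 ?_
  rintro w ⟨j, hj, rfl⟩
  refine ⟨Pi.single j (mono k (a - T.γ j)), ?_⟩
  funext i
  simp only [Matrix.mulVecLin_apply, Matrix.mulVec_single, toMatrix, F, LinearMap.pi_apply,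
    LinearMap.comp_apply, LinearMap.proj_apply, LinearMap.toSpanSingleton_apply]
  simp only [Pi.smul_apply, Matrix.col_apply, Matrix.of_apply, MulOpposite.smul_eq_mul_unop,
    MulOpposite.unop_op]
  by_cases hc : A.coeff i j = 0
  · simp [hc]
  · have h1 : 0 ≤ a - T.γ j := sub_nonneg.2 hj
    have h2 : 0 ≤ a - T.β i := sub_nonneg.2 ((T.β_le_γ hc).trans hj)
    rw [mono_of_nonneg h1, mono_of_nonneg h2, MvPolynomial.monomial_mul,
      MvPolynomial.smul_monomial]
    simp only [mul_one, smul_eq_mul]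
    refine congrArg (fun e => MvPolynomial.monomial e (A.coeff i j)) (Finsupp.ext fun c => ?_)
    have h3 := T.eqn i j hc c
    have h4 : T.γ j c ≤ a c := hj c
    simp only [Finsupp.add_apply, natExp_apply, Pi.sub_apply]
    omega

theorem intCoeff_mem_colSpan {f : Fin s → MvPolynomial (Fin n) k} (hf : f ∈ A.relations)
    (a : Fin n → ℤ) : (fun i => intCoeff k (a - T.β i) (f i)) ∈ T.colSpan a := by
  obtain ⟨p, rfl⟩ := hf
  have : (fun i => intCoeff k (a - T.β i) (A.toMatrix.mulVecLin p i)) =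
      ∑ j, intCoeff k (a - T.γ j) (p j) • fun i => A.coeff i j := by
    funext i
    simp only [Matrix.mulVecLin_apply, Matrix.mulVec, dotProduct, toMatrix, Matrix.of_apply,
      map_sum, Finset.sum_apply, Pi.smul_apply, smul_eq_mul]
    refine Finset.sum_congr rfl fun j _ => ?_
    rw [intCoeff_monomial_mul]
    by_cases hc : A.coeff i j = 0
    · simp [hc]
    · rw [mul_comm]
      congr 3
      funext c
      have := T.eqn i j hc c
      simp only [Pi.sub_apply]
      omega
  rw [this]
  refine Submodule.sum_mem _ fun j _ => ?_
  by_cases h : 0 ≤ a - T.γ j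
  · exact Submodule.smul_mem _ _ (Submodule.subset_span ⟨j, sub_nonneg.1 h, rfl⟩)
  · rw [intCoeff_of_not_nonneg h, zero_smul]
    exact Submodule.zero_mem _

/-! ### The initial ideals -/

/-- The monomials that occur in an element of the initial module are in pivot positions of the
relations of the same degree. -/
theorem isPivot_of_mem_initialModule (m : MonomialOrder (Fin n))
    {g : Fin s → MvPolynomial (Fin n) k} (hg : g ∈ initialModule m A.relations) (i : Fin s)
    (b : Fin n →₀ ℕ) (hb : (g i).coeff b ≠ 0) :
    IsPivot (T.colSpan ((fun c => (b c : ℤ)) + T.β i)) i := by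
  induction hg using Submodule.span_induction generalizing i b with
  | mem g hg =>
    obtain ⟨f, hf, d, hd, hlast, rfl⟩ := hg
    have hid : i = d := by
      by_contra h
      simp [h] at hb
    subst hid
    rw [Pi.single_eq_same, MonomialOrder.leadingTerm, MvPolynomial.coeff_monomial] at hb
    have hdeg : m.degree (f i) = b := by
      by_contra h
      simp [h] at hb
    refine ⟨_, T.intCoeff_mem_colSpan hf _, ?_, fun j hj => ?_⟩
    · rw [add_sub_cancel_right, intCoeff_of_nonneg (fun c => by simp), natExp_natCast, ← hdeg]
      exact m.leadingCoeff_ne_zero_iff.2 hd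
    · simp [hlast j hj]
  | zero => simp at hb
  | add g h _ _ ihg ihh =>
    rw [Pi.add_apply, MvPolynomial.coeff_add] at hb
    by_cases h0 : (g i).coeff b = 0
    · exact ihh i b (by simpa [h0] using hb)
    · exact ihg i b h0
  | smul p g _ ih =>
    rw [Pi.smul_apply, smul_eq_mul, MvPolynomial.coeff_mul] at hb
    obtain ⟨⟨x, y⟩, hxy, hne⟩ := Finset.exists_ne_zero_of_sum_ne_zero hb
    obtain ⟨v, hv, hvi⟩ := ih i y (right_ne_zero_of_mul hne)
    refine ⟨v, T.colSpan_mono ?_ hv, hvi⟩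
    rw [Finset.HasAntidiagonal.mem_antidiagonal] at hxy
    subst hxy
    intro c
    simp

theorem mono_mem_initialIdeal_iff (m : MonomialOrder (Fin n)) (i : Fin s) {b : Fin n → ℤ}
    (hb : 0 ≤ b) :
    mono k b ∈ initialIdeal m A.relations i ↔ IsPivot (T.colSpan (b + T.β i)) i := by
  rw [initialIdeal, Submodule.mem_comap, LinearMap.coe_single]
  constructor
  · intro h
    have := T.isPivot_of_mem_initialModule m h i (natExp b)
      (by simp [mono_of_nonneg hb])
    convert this using 3
    funext c
    have := hb c
    simpa using this
  · rintro ⟨v, hv, hvi, hlast⟩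
    have hf := T.mem_relations_of_mem_colSpan hv
    have hlt : v i • mono k b = m.leadingTerm (v i • mono k (b + T.β i - T.β i)) := by
      rw [add_sub_cancel_right, mono_of_nonneg hb, MvPolynomial.smul_monomial,
        MonomialOrder.leadingTerm_monomial]
    have hmem : (Pi.single i (v i • mono k b) : Fin s → MvPolynomial (Fin n) k) ∈
        initialModule m A.relations := by
      refine Submodule.subset_span ⟨_, hf, i, ?_, fun j hj => by simp [hlast j hj], by rw [hlt]⟩
      rw [add_sub_cancel_right, mono_of_nonneg hb, MvPolynomial.smul_monomial]
      simpa using hvi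
    have := (initialModule m A.relations).smul_of_tower_mem (v i)⁻¹ hmem
    rwa [← Pi.single_smul, smul_smul, inv_mul_cancel₀ hvi, one_smul] at this

theorem supp_mem_cplx_iff (m : MonomialOrder (Fin n)) (i : Fin s) {b : Fin n → ℤ} (hb : 0 ≤ b) :
    supp b ∈ (A.cplx m i).faces ↔ ¬ IsPivot (T.colSpan (b + T.β i)) i := by
  rw [← T.colSpan_ind_supp hb, ← T.mono_mem_initialIdeal_iff m i (ind_nonneg _), ← prod_X_eq_mono]
  rfl

/-! ### Bases of the graded pieces of the cokernel -/

/-- The linear map `k^s → M_A` that sends `c` to the class of `∑ c_i x^(a - β_i) v_i`. -/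
def classMap (a : Fin n → ℤ) : (Fin s → k) →ₗ[k] A.Mod :=
  (A.relations.mkQ.restrictScalars k) ∘ₗ
    LinearMap.pi fun i => (LinearMap.toSpanSingleton k _ (mono k (a - T.β i))) ∘ₗ LinearMap.proj i

theorem classMap_apply (a : Fin n → ℤ) (c : Fin s → k) :
    T.classMap a c = A.relations.mkQ fun i => c i • mono k (a - T.β i) := rfl

theorem smul_cls (c : k) (i : Fin s) (p : MvPolynomial (Fin n) k) :
    c • A.cls i p = A.cls i (c • p) := by
  rw [cls, cls, Pi.single_smul, LinearMap.map_smul_of_tower]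

theorem smul_cls_mul (q : MvPolynomial (Fin n) k) (i : Fin s) (p : MvPolynomial (Fin n) k) :
    q • A.cls i p = A.cls i (q * p) := by
  rw [cls, cls, ← smul_eq_mul, Pi.single_smul, map_smul]

theorem classMap_eq_sum (a : Fin n → ℤ) (c : Fin s → k) :
    T.classMap a c = ∑ i, c i • A.cls i (mono k (a - T.β i)) := by
  simp only [smul_cls]
  rw [classMap_apply]
  simp only [cls]
  rw [← map_sum, Finset.univ_sum_single]

theorem classMap_single (a : Fin n → ℤ) (i : Fin s) :
    T.classMap a (Pi.single i 1) = A.cls i (mono k (a - T.β i)) := by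
  rw [classMap_eq_sum, Finset.sum_eq_single i]
  · simp
  · intro j _ hj; simp [hj]
  · simp

theorem classMap_eq_zero_of_mem {a : Fin n → ℤ} {c : Fin s → k} (h : c ∈ T.colSpan a) :
    T.classMap a c = 0 := by
  rw [classMap_apply, Submodule.mkQ_apply, Submodule.Quotient.mk_eq_zero]
  exact T.mem_relations_of_mem_colSpan h

theorem mem_colSpan_of_classMap_eq_zero {a : Fin n → ℤ} {c : Fin s → k}
    (hc : ∀ i, c i ≠ 0 → 0 ≤ a - T.β i) (h : T.classMap a c = 0) : c ∈ T.colSpan a := by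
  rw [classMap_apply, Submodule.mkQ_apply, Submodule.Quotient.mk_eq_zero] at h
  convert T.intCoeff_mem_colSpan h a using 1
  funext i
  rw [map_smul]
  by_cases hi : c i = 0
  · simp [hi]
  · rw [intCoeff_mono (hc i hi), smul_eq_mul, mul_one]

/-- The class of `x^(a - β_j) v_j` is a standard monomial of `M_A` in degree `a`. -/
def IsStandard (m : MonomialOrder (Fin n)) (a : Fin n → ℤ) (j : Fin s) : Prop :=
  0 ≤ a - T.β j ∧ supp (a - T.β j) ∈ (A.cplx m j).faces

theorem isStandard_iff (m : MonomialOrder (Fin n)) (a : Fin n → ℤ) (j : Fin s) :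
    T.IsStandard m a j ↔ 0 ≤ a - T.β j ∧ ¬ IsPivot (T.colSpan a) j := by
  refine and_congr_right fun h => ?_
  rw [T.supp_mem_cplx_iff m j h, sub_add_cancel]

/-- The standard monomials of a given degree are linearly independent in `M_A`. -/
theorem eq_of_classMap_eq (m : MonomialOrder (Fin n)) {a : Fin n → ℤ} {c c' : Fin s → k}
    (hc : ∀ j, c j ≠ 0 → T.IsStandard m a j) (hc' : ∀ j, c' j ≠ 0 → T.IsStandard m a j)
    (h : T.classMap a c = T.classMap a c') : c = c' := by
  have hs : ∀ j, (c - c') j ≠ 0 → T.IsStandard m a j := by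
    intro j hj
    by_cases h0 : c j = 0
    · exact hc' j fun h1 => hj (by simp [h0, h1])
    · exact hc j h0
  rw [← sub_eq_zero]
  refine eq_zero_of_forall_not_isPivot (V := T.colSpan a) ?_
    fun j hj => ((T.isStandard_iff m a j).1 (hs j hj)).2
  exact T.mem_colSpan_of_classMap_eq_zero (fun j hj => (hs j hj).1) (by rw [map_sub, h, sub_self])

theorem exists_standard_expansion_cls (m : MonomialOrder (Fin n)) {a : Fin n → ℤ} (i : Fin s)
    (hi : 0 ≤ a - T.β i) :
    ∃ c : Fin s → k, (∀ j, c j ≠ 0 → j ≤ i ∧ T.IsStandard m a j) ∧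
      A.cls i (mono k (a - T.β i)) = T.classMap a c := by
  obtain ⟨c, h1, h2⟩ := exists_reduction (T.colSpan a) (fun j => 0 ≤ a - T.β j)
    (fun v hv j hj => sub_nonneg.2 (T.β_le_of_mem_colSpan hv hj)) i hi
  refine ⟨c, fun j hj => ⟨(h2 j hj).1, (T.isStandard_iff m a j).2 (h2 j hj).2.symm⟩, ?_⟩
  have := T.classMap_eq_zero_of_mem h1
  rwa [map_sub, sub_eq_zero, classMap_single] at this

/-- The standard monomials of degree `a` span the piece of degree `a` of `M_A`. -/
theorem exists_standard_expansion (m : MonomialOrder (Fin n)) {a : Fin n → ℤ} {y : A.Mod}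
    (hy : y ∈ T.modPiece a) :
    ∃ c : Fin s → k, (∀ j, c j ≠ 0 → T.IsStandard m a j) ∧ y = T.classMap a c := by
  obtain ⟨f, hf, rfl⟩ := hy
  have hex : ∀ i, ∃ c : Fin s → k, (∀ j, c j ≠ 0 → T.IsStandard m a j) ∧
      A.cls i (f i) = T.classMap a c := by
    intro i
    obtain ⟨d, hd⟩ := mem_polyPiece_iff.1 (hf i (Set.mem_univ i))
    by_cases hi : 0 ≤ a - T.β i
    · obtain ⟨c, h1, h2⟩ := T.exists_standard_expansion_cls m i hi
      refine ⟨d • c, fun j hj => (h1 j (right_ne_zero_of_mul hj)).2, ?_⟩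
      rw [hd, ← smul_cls, h2, map_smul]
    · refine ⟨0, fun j hj => absurd rfl hj, ?_⟩
      rw [hd, mono_of_not_nonneg hi]
      simp [cls]
  choose c h1 h2 using hex
  refine ⟨∑ i, c i, fun j hj => ?_, ?_⟩
  · rw [Finset.sum_apply] at hj
    obtain ⟨i, -, hi⟩ := Finset.exists_ne_zero_of_sum_ne_zero hj
    exact h1 i j hi
  · rw [map_sum, ← Finset.sum_congr rfl fun i _ => h2 i]
    simp only [cls]
    rw [← map_sum, Finset.univ_sum_single]
    rfl

theorem cls_mono_mem_modPiece (a : Fin n → ℤ) (i : Fin s) :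
    A.cls i (mono k (a - T.β i)) ∈ T.modPiece a := by
  refine ⟨Pi.single i (mono k (a - T.β i)), fun j _ => ?_, rfl⟩
  by_cases h : j = i
  · subst h
    rw [Pi.single_eq_same]
    exact mem_polyPiece_iff.2 ⟨1, by simp⟩
  · rw [Pi.single_eq_of_ne h]
    exact Submodule.zero_mem _

theorem smul_mem_modPiece {a b : Fin n → ℤ} {p : MvPolynomial (Fin n) k} {y : A.Mod}
    (hp : p ∈ polyPiece k b) (hy : y ∈ T.modPiece a) : p • y ∈ T.modPiece (a + b) := by
  obtain ⟨f, hf, rfl⟩ := hy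
  refine ⟨p • f, fun i _ => ?_, ?_⟩
  · obtain ⟨c, hc⟩ := mem_polyPiece_iff.1 (hf i (Set.mem_univ i))
    obtain ⟨d, hd⟩ := mem_polyPiece_iff.1 hp
    rw [Pi.smul_apply, hc, hd, smul_eq_mul, smul_mul_smul_comm]
    by_cases h1 : 0 ≤ b
    · by_cases h2 : 0 ≤ a - T.β i
      · rw [mono_mul_mono h1 h2]
        exact mem_polyPiece_iff.2 ⟨d * c, by congr 2; abel⟩
      · rw [mono_of_not_nonneg h2, mul_zero, smul_zero]
        exact Submodule.zero_mem _
    · rw [mono_of_not_nonneg h1, zero_mul, smul_zero]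
      exact Submodule.zero_mem _
  · exact map_smul A.relations.mkQ p f

/-! ### The coefficients of the expansions -/

theorem isExpansion_iff (m : MonomialOrder (Fin n)) (i : Fin s) (a : Fin n → ℤ) (c : Fin s → k) :
    T.IsExpansion m i a c ↔ (∀ j, c j ≠ 0 → j < i ∧ T.IsStandard m (a + T.β i) j) ∧
      A.cls i (mono k a) = T.classMap (a + T.β i) c := by
  refine and_congr_right fun h => ?_
  rw [classMap_eq_sum, Finset.sum_filter_of_ne]
  intro j _ hj
  refine (h j fun h0 => hj ?_).1
  rw [h0, zero_smul]

theorem existsUnique_isExpansion (m : MonomialOrder (Fin n)) (i : Fin s) (a : Fin n → ℤ)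
    (ha : 0 ≤ a) (hi : supp a ∉ (A.cplx m i).faces) : ∃! c : Fin s → k, T.IsExpansion m i a c := by
  have hi' : ¬ T.IsStandard m (a + T.β i) i := by
    rw [IsStandard, add_sub_cancel_right]
    exact fun h => hi h.2
  obtain ⟨c, h1, h2⟩ := T.exists_standard_expansion_cls m (a := a + T.β i) i
    (by rwa [add_sub_cancel_right])
  rw [add_sub_cancel_right] at h2
  refine ⟨c, (T.isExpansion_iff m i a c).2 ⟨fun j hj => ⟨?_, (h1 j hj).2⟩, h2⟩, fun c' hc' => ?_⟩
  · refine lt_of_le_of_ne (h1 j hj).1 ?_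
    rintro rfl
    exact hi' (h1 _ hj).2
  · obtain ⟨h3, h4⟩ := (T.isExpansion_iff m i a c').1 hc'
    exact T.eq_of_classMap_eq m (fun j hj => (h3 j hj).2) (fun j hj => (h1 j hj).2) (h4 ▸ h2)

theorem isExpansion_r (m : MonomialOrder (Fin n)) (i : Fin s) (a : Fin n → ℤ)
    (ha : 0 ≤ a) (hi : supp a ∉ (A.cplx m i).faces) :
    T.IsExpansion m i a fun j => T.r m i j a := by
  have h := (T.existsUnique_isExpansion m i a ha hi).exists
  have : (fun j => T.r m i j a) = h.choose := by
    funext j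
    rw [r, dif_pos h]
  rw [this]
  exact h.choose_spec

end SquarefreeSolution

end MonomialMatrix

/-! ### Signs and supports -/

section Signs

variable {n : ℕ}

theorem sgn_mul_self (t : Fin n) (L : Finset (Fin n)) : sgn t L * sgn t L = 1 := by
  rw [sgn, ← mul_pow, neg_one_mul, neg_neg, one_pow]

theorem sgnSet_mul_self (W L : Finset (Fin n)) : sgnSet W L * sgnSet W L = 1 := by
  rw [sgnSet, ← Finset.prod_mul_distrib]
  exact Finset.prod_eq_one fun w _ => sgn_mul_self w L

theorem sgnSet_cast_mul_self (k : Type*) [Field k] (W L : Finset (Fin n)) :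
    ((sgnSet W L : ℤ) : k) * ((sgnSet W L : ℤ) : k) = 1 := by
  rw [← Int.cast_mul, sgnSet_mul_self, Int.cast_one]

theorem sgnSet_cast_ne_zero (k : Type*) [Field k] (W L : Finset (Fin n)) :
    ((sgnSet W L : ℤ) : k) ≠ 0 :=
  left_ne_zero_of_mul_eq_one (sgnSet_cast_mul_self k W L)

theorem sgn_erase_of_not_lt {t u : Fin n} {L : Finset (Fin n)} (h : ¬ t < u) :
    sgn u (L.erase t) = sgn u L := by
  rw [sgn, sgn, Finset.filter_erase, Finset.erase_eq_of_notMem (by simp [h])]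

theorem sgn_erase_of_lt {t u : Fin n} {L : Finset (Fin n)} (ht : t ∈ L) (h : t < u) :
    sgn u (L.erase t) = -sgn u L := by
  have hmem : t ∈ L.filter fun v => v < u := by simp [ht, h]
  rw [sgn, sgn, Finset.filter_erase, ← Finset.card_erase_add_one hmem, pow_succ]
  ring

theorem sgn_mul_sgn_erase {t u : Fin n} {L : Finset (Fin n)} (ht : t ∈ L) (hu : u ∈ L)
    (h : t ≠ u) : sgn t L * sgn u (L.erase t) = -(sgn u L * sgn t (L.erase u)) := by
  rcases lt_or_gt_of_ne h with h | h
  · rw [sgn_erase_of_lt ht h, sgn_erase_of_not_lt (not_lt.2 h.le)]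
    ring
  · rw [sgn_erase_of_lt hu h, sgn_erase_of_not_lt (not_lt.2 h.le)]
    ring

theorem sgn_insert_self (t : Fin n) (τ : Finset (Fin n)) : sgn t (insert t τ) = sgn t τ := by
  rw [sgn, sgn, Finset.filter_insert, if_neg (lt_irrefl t)]

theorem sgn_eq_mul_sdiff (t : Fin n) {τ σ : Finset (Fin n)} (h : τ ⊆ σ) :
    sgn t σ = sgn t τ * sgn t (σ \ τ) := by
  rw [sgn, sgn, sgn, ← pow_add, ← Finset.card_union_of_disjoint, ← Finset.filter_union,
    Finset.union_sdiff_of_subset h]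
  exact Finset.disjoint_filter_filter Finset.disjoint_sdiff

/-- The identity that turns the signs of the simplicial coboundary into those of the Koszul
differential on complements. -/
theorem sgn_insert_mul_sgnSet_insert {t : Fin n} {τ σ : Finset (Fin n)} (h : τ ⊆ σ)
    (ht : t ∉ τ) :
    sgn t (insert t τ) * sgnSet (insert t τ) σ = sgnSet τ σ * sgn t (σ \ τ) := by
  rw [sgn_insert_self, sgnSet, Finset.prod_insert ht, sgn_eq_mul_sdiff t h, sgnSet]
  linear_combination (∏ w ∈ τ, sgn w σ) * sgn t (σ \ τ) * sgn_mul_self t τ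

theorem sub_ind_nonneg_iff {b : Fin n → ℤ} {L : Finset (Fin n)} :
    0 ≤ b - ind L ↔ 0 ≤ b ∧ L ⊆ supp b := by
  constructor
  · intro h
    refine ⟨h.trans (sub_le_self _ (ind_nonneg L)), fun c hc => ?_⟩
    have := h c
    simp only [Pi.zero_apply, Pi.sub_apply, ind, if_pos hc] at this
    rw [mem_supp]
    omega
  · rintro ⟨h0, hL⟩ c
    have h1 := h0 c
    simp only [Pi.zero_apply, Pi.sub_apply, ind] at h1 ⊢
    split_ifs with hc
    · have := mem_supp.1 (hL hc)
      omega
    · omega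

theorem supp_sub_ind {b : Fin n → ℤ} {L : Finset (Fin n)} (hL : L ⊆ supp b) :
    supp (b - ind L) = (supp b \ L) ∪ supp (b - ind (supp b)) := by
  ext c
  have := @hL c
  by_cases hc : c ∈ L
  · simp [mem_supp, ind, hc, mem_supp.1 (this hc)]
  · by_cases hb : b c = 0 <;> simp [mem_supp, ind, hc, hb]

end Signs

/-! ### The Koszul complex -/

section Koszul

variable {k : Type*} [Field k] {n : ℕ}

theorem koszulBasis_of_card {p : ℤ} {L : Finset (Fin n)} (h : (L.card : ℤ) = p) :
    koszulBasis k p L = Finsupp.single ⟨L, h⟩ 1 := by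
  simp [koszulBasis, h]

theorem koszulBasis_of_card_ne {p : ℤ} {L : Finset (Fin n)} (h : (L.card : ℤ) ≠ p) :
    koszulBasis k p L = 0 := by
  simp [koszulBasis, h]

theorem koszulDiff_koszulBasis {p q : ℤ} {L : Finset (Fin n)} (h : (L.card : ℤ) = p) :
    koszulDiff k n p q (koszulBasis k p L) =
      ∑ t ∈ L, ((sgn t L : ℤ) : MvPolynomial (Fin n) k) •
        (MvPolynomial.X t : MvPolynomial (Fin n) k) • koszulBasis k q (L.erase t) := by
  rw [koszulBasis_of_card h, koszulDiff, Finsupp.linearCombination_single, one_smul]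

theorem koszulDiff_comp_koszulDiff (p : ℤ) {q q' : ℤ} (hq : q = p - 1) :
    koszulDiff k n q q' ∘ₗ koszulDiff k n p q = 0 := by
  refine Finsupp.lhom_ext' fun L => LinearMap.ext_ring ?_
  obtain ⟨L, hL⟩ := L
  simp only [LinearMap.comp_apply, Finsupp.lsingle_apply, LinearMap.zero_apply]
  rw [← koszulBasis_of_card hL, koszulDiff_koszulBasis hL, map_sum]
  have hterm : ∀ t ∈ L, koszulDiff k n q q' (((sgn t L : ℤ) : MvPolynomial (Fin n) k) •
        (MvPolynomial.X t : MvPolynomial (Fin n) k) • koszulBasis k q (L.erase t)) =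
      ∑ u ∈ L.erase t, ((sgn t L * sgn u (L.erase t) : ℤ) : MvPolynomial (Fin n) k) •
        (MvPolynomial.X t * MvPolynomial.X u : MvPolynomial (Fin n) k) •
          koszulBasis k q' ((L.erase t).erase u) := by
    intro t ht
    have hc : ((L.erase t).card : ℤ) = q := by
      rw [Finset.card_erase_of_mem ht, hq, ← hL]
      have := Finset.card_pos.2 ⟨t, ht⟩
      omega
    rw [map_smul, map_smul, koszulDiff_koszulBasis hc, Finset.smul_sum, Finset.smul_sum]
    refine Finset.sum_congr rfl fun u _ => ?_
    simp only [smul_smul, Int.cast_mul]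
    congr 1
    ring
  rw [Finset.sum_congr rfl hterm, Finset.sum_sigma']
  refine Finset.sum_involution (fun x _ => ⟨x.2, x.1⟩) ?_ ?_ ?_ ?_
  · rintro ⟨t, u⟩ h
    simp only [Finset.mem_sigma, Finset.mem_erase] at h
    obtain ⟨ht, hut, hu⟩ := h
    simp only
    rw [sgn_mul_sgn_erase hu ht hut, Finset.erase_right_comm, mul_comm (MvPolynomial.X u),
      Int.cast_neg, neg_smul, add_neg_cancel]
  · rintro ⟨t, u⟩ h _ heq
    simp only [Finset.mem_sigma, Finset.mem_erase] at h
    exact h.2.1 (congrArg Sigma.fst heq)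
  · rintro ⟨t, u⟩ h
    simp only [Finset.mem_sigma, Finset.mem_erase] at h ⊢
    exact ⟨h.2.2, h.2.1.symm, h.1⟩
  · rintro ⟨t, u⟩ _
    rfl

theorem koszulBasis_mem_koszulPiece {p : ℤ} {L : Finset (Fin n)} (h : (L.card : ℤ) = p) :
    koszulBasis k p L ∈ koszulPiece k p (ind L) := by
  rw [koszulPiece, Submodule.mem_iInf]
  intro L'
  rw [Submodule.mem_comap]
  simp only [LinearMap.coe_restrictScalars, Finsupp.lapply_apply]
  rw [koszulBasis_of_card h, Finsupp.single_apply]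
  split_ifs with hL
  · rw [← hL, sub_self]
    exact mem_polyPiece_iff.2 ⟨1, by rw [mono_zero, one_smul]⟩
  · exact Submodule.zero_mem _

theorem apply_mem_polyPiece {p : ℤ} {b : Fin n → ℤ} {z : Koszul k n p}
    (hz : z ∈ koszulPiece k p b) (L : {L : Finset (Fin n) // (L.card : ℤ) = p}) :
    z L ∈ polyPiece k (b - ind L.1) := by
  rw [koszulPiece, Submodule.mem_iInf] at hz
  exact hz L

end Koszul

/-! ### Cochains and direct sums -/

section Cochains

variable {k : Type*} [Field k] {n : ℕ}

theorem sum_comp_proj_single {ι N : Type*} [Fintype ι] [DecidableEq ι] {M : ι → Type*}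
    [∀ i, AddCommGroup (M i)] [∀ i, Module k (M i)] [AddCommGroup N] [Module k N]
    (f : ∀ i, M i →ₗ[k] N) (i : ι) (x : M i) :
    (∑ j, f j ∘ₗ LinearMap.proj j) (Pi.single i x) = f i x := by
  rw [LinearMap.sum_apply, Finset.sum_eq_single i]
  · simp
  · intro j _ hj
    simp [hj]
  · simp

theorem single_eq_star {Δ : FaceComplex n} {j : ℤ}
    (τ : {τ : Finset (Fin n) // τ ∈ Δ.faces ∧ (τ.card : ℤ) = j + 1}) :
    (Finsupp.single τ 1 : Cochain k Δ j) = star k Δ j τ.1 := by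
  rw [star, dif_pos τ.2]

end Cochains

namespace MonomialMatrix

namespace SquarefreeSolution

variable {k : Type*} [Field k] {n s l : ℕ} {A : MonomialMatrix k n s l} (T : A.SquarefreeSolution)

/-! ### The comparison map -/

/-- The faces of `Δ_{j,α}` are the complements in `supp α_j` of the sets `L` for which `v_j`
contributes a standard monomial to `M_A` in degree `α - ind L`. -/
theorem isStandard_sub_ind_iff (m : MonomialOrder (Fin n)) (α : Fin n → ℤ) (j : Fin s)
    (L : Finset (Fin n)) :
    T.IsStandard m (α - ind L) j ↔
      L ⊆ supp (T.shift α j) ∧ supp (T.shift α j) \ L ∈ (T.cplxAt m α j).faces := by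
  rw [IsStandard, sub_right_comm]
  change 0 ≤ T.shift α j - ind L ∧ supp (T.shift α j - ind L) ∈ _ ↔
    _ ∧ (0 ≤ T.shift α j ∧ supp (T.shift α j) \ L ⊆ supp (T.shift α j) ∧ _)
  rw [sub_ind_nonneg_iff]
  constructor
  · rintro ⟨⟨h0, hL⟩, h⟩
    rw [supp_sub_ind hL] at h
    exact ⟨hL, h0, Finset.sdiff_subset, h⟩
  · rintro ⟨hL, h0, -, h⟩
    rw [supp_sub_ind hL]
    exact ⟨⟨h0, hL⟩, h⟩

theorem subset_of_mem_cplxAt {m : MonomialOrder (Fin n)} {α : Fin n → ℤ} {j : Fin s}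
    {τ : Finset (Fin n)} (h : τ ∈ (T.cplxAt m α j).faces) : τ ⊆ supp (T.shift α j) := h.2.1

theorem isStandard_of_mem_cplxAt {m : MonomialOrder (Fin n)} {α : Fin n → ℤ} {j : Fin s}
    {τ : Finset (Fin n)} (h : τ ∈ (T.cplxAt m α j).faces) :
    T.IsStandard m (α - ind (supp (T.shift α j) \ τ)) j := by
  rw [isStandard_sub_ind_iff, Finset.sdiff_sdiff_eq_self (T.subset_of_mem_cplxAt h)]
  exact ⟨Finset.sdiff_subset, h⟩

/-- The element `x^(α_j - ind L) v_j ⊗ e_L` of `M_A ⊗ K_p`. -/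
def tensorMono (α : Fin n → ℤ) (p : ℤ) (j : Fin s) (L : Finset (Fin n)) :
    A.Mod ⊗[MvPolynomial (Fin n) k] Koszul k n p :=
  A.cls j (mono k (α - ind L - T.β j)) ⊗ₜ koszulBasis k p L

theorem tensorMono_mem_tensorPiece (α : Fin n → ℤ) (p : ℤ) (j : Fin s) (L : Finset (Fin n)) :
    T.tensorMono α p j L ∈ T.tensorPiece α p := by
  by_cases h : (L.card : ℤ) = p
  · exact Submodule.subset_span ⟨α - ind L, ind L, sub_add_cancel _ _, _,
      T.cls_mono_mem_modPiece _ j, _, koszulBasis_mem_koszulPiece h, rfl⟩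
  · rw [tensorMono, koszulBasis_of_card_ne h, TensorProduct.tmul_zero]
    exact Submodule.zero_mem _

theorem lTensor_koszulDiff_tensorMono {α : Fin n → ℤ} {p q : ℤ} {j : Fin s}
    {L : Finset (Fin n)} (hL : (L.card : ℤ) = p) (h : 0 ≤ α - ind L - T.β j) :
    LinearMap.lTensor A.Mod (koszulDiff k n p q) (T.tensorMono α p j L) =
      ∑ w ∈ L, ((sgn w L : ℤ) : k) • T.tensorMono α q j (L.erase w) := by
  rw [tensorMono, LinearMap.lTensor_tmul, koszulDiff_koszulBasis hL, TensorProduct.tmul_sum]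
  refine Finset.sum_congr rfl fun w hw => ?_
  -- Multiplication by `x_w` turns `x^(α_j - ind L)` into `x^(α_j - ind (L \ w))`.
  have hind : ind {w} + (α - ind L - T.β j) = α - ind (L.erase w) - T.β j := by
    funext c
    by_cases hc : c = w
    · subst hc
      simp only [ind, Pi.add_apply, Pi.sub_apply, Finset.mem_singleton, if_true, hw,
        Finset.notMem_erase, if_false]
      ring
    · simp [ind, hc]
  rw [TensorProduct.tmul_smul, TensorProduct.tmul_smul, TensorProduct.smul_tmul', smul_cls_mul,
    X_eq_mono, mono_mul_mono (ind_nonneg _) h, hind]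
  exact (Int.cast_smul_eq_zsmul (MvPolynomial (Fin n) k) _ _).trans
    (Int.cast_smul_eq_zsmul k (sgn w L) (T.tensorMono α q j (L.erase w))).symm

variable [NeZero s]

theorem glued_hom_ext {m : MonomialOrder (Fin n)} {α : Fin n → ℤ} {t : ℤ} {N : Type*}
    [AddCommGroup N] [Module k N] {f g : T.Glued m α t →ₗ[k] N}
    (h : ∀ j τ, f (Pi.single j (Finsupp.single τ 1)) = g (Pi.single j (Finsupp.single τ 1))) :
    f = g :=
  LinearMap.pi_ext' fun j => Finsupp.lhom_ext' fun τ => LinearMap.ext_ring (h j τ)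

/-- The comparison map `C^t(A,α) → M_A ⊗ K_p` for `p = |supp α_1| - t - 1`. With
`L = supp α_j \ τ`, it sends `τ^*` to `sgn[τ, supp α_j] x^(α_j - ind L) v_j ⊗ e_L`. -/
def comparison (m : MonomialOrder (Fin n)) (α : Fin n → ℤ) (t : ℤ) :
    T.Glued m α t →ₗ[k] A.Mod ⊗[MvPolynomial (Fin n) k]
      Koszul k n (((supp (T.shift α 0)).card : ℤ) - t - 1) :=
  ∑ j : Fin s, (Finsupp.linearCombination k fun τ =>
    ((sgnSet τ.1 (supp (T.shift α j)) : ℤ) : k) •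
      T.tensorMono α (((supp (T.shift α 0)).card : ℤ) - t - 1) j (supp (T.shift α j) \ τ.1)) ∘ₗ
    LinearMap.proj j

theorem comparison_single (m : MonomialOrder (Fin n)) (α : Fin n → ℤ) (t : ℤ) (j : Fin s)
    (τ : {τ : Finset (Fin n) // τ ∈ (T.cplxAt m α j).faces ∧
      (τ.card : ℤ) = t + T.offset α j + 1}) :
    T.comparison m α t (Pi.single j (Finsupp.single τ 1)) =
      ((sgnSet τ.1 (supp (T.shift α j)) : ℤ) : k) •
        T.tensorMono α (((supp (T.shift α 0)).card : ℤ) - t - 1) j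
          (supp (T.shift α j) \ τ.1) := by
  rw [comparison, sum_comp_proj_single, Finsupp.linearCombination_single, one_smul]

theorem card_sdiff_eq_iff {α : Fin n → ℤ} {t : ℤ} {j : Fin s} {τ : Finset (Fin n)}
    (h : τ ⊆ supp (T.shift α j)) :
    ((supp (T.shift α j) \ τ).card : ℤ) = ((supp (T.shift α 0)).card : ℤ) - t - 1 ↔
      (τ.card : ℤ) = t + T.offset α j + 1 := by
  rw [Finset.card_sdiff_of_subset h, Nat.cast_sub (Finset.card_le_card h), offset]
  constructor <;> intro h <;> linarith

/-- For a face of the wrong cardinality, both sides are zero. -/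
theorem comparison_star {m : MonomialOrder (Fin n)} {α : Fin n → ℤ} (t : ℤ) {j : Fin s}
    {τ : Finset (Fin n)} (hτ : τ ∈ (T.cplxAt m α j).faces) :
    T.comparison m α t (Pi.single j (star k (T.cplxAt m α j) (t + T.offset α j) τ)) =
      ((sgnSet τ (supp (T.shift α j)) : ℤ) : k) •
        T.tensorMono α (((supp (T.shift α 0)).card : ℤ) - t - 1) j
          (supp (T.shift α j) \ τ) := by
  by_cases hc : (τ.card : ℤ) = t + T.offset α j + 1
  · rw [← single_eq_star ⟨τ, hτ, hc⟩, comparison_single]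
  · have hc' := (T.card_sdiff_eq_iff (t := t) (T.subset_of_mem_cplxAt hτ)).not.2 hc
    rw [star, dif_neg (fun h => hc h.2), Pi.single_zero, map_zero, tensorMono,
      koszulBasis_of_card_ne hc', TensorProduct.tmul_zero, smul_zero]

theorem range_comparison (m : MonomialOrder (Fin n)) (α : Fin n → ℤ) (t : ℤ) :
    LinearMap.range (T.comparison m α t) =
      T.tensorPiece α (((supp (T.shift α 0)).card : ℤ) - t - 1) := by
  apply le_antisymm
  · rintro _ ⟨x, rfl⟩
    rw [comparison, LinearMap.sum_apply]
    refine Submodule.sum_mem _ fun j _ => ?_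
    rw [LinearMap.comp_apply, Finsupp.linearCombination_apply]
    exact Submodule.sum_mem _ fun τ _ => Submodule.smul_mem _ _
      (Submodule.smul_mem _ _ (T.tensorMono_mem_tensorPiece _ _ _ _))
  · refine Submodule.span_le.2 ?_
    rintro _ ⟨a, b, hab, y, hy, z, hz, rfl⟩
    rw [← Finsupp.sum_single z, Finsupp.sum, TensorProduct.tmul_sum]
    refine Submodule.sum_mem _ fun L _ => ?_
    obtain ⟨L, hL⟩ := L
    -- A homogeneous element `y ⊗ p e_L` equals `p y ⊗ e_L`, where `p y` has degree `α - ind L`.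
    have hmem := T.smul_mem_modPiece (apply_mem_polyPiece hz ⟨L, hL⟩) hy
    rw [← add_sub_assoc, hab] at hmem
    obtain ⟨c, hc, hy'⟩ := T.exists_standard_expansion m hmem
    have hs : (Finsupp.single ⟨L, hL⟩ (z ⟨L, hL⟩) : Koszul k n _) =
        z ⟨L, hL⟩ • koszulBasis k _ L := by
      rw [koszulBasis_of_card hL, Finsupp.smul_single, smul_eq_mul, mul_one]
    rw [hs, TensorProduct.tmul_smul, TensorProduct.smul_tmul', hy', classMap_eq_sum,
      TensorProduct.sum_tmul]
    refine Submodule.sum_mem _ fun j _ => ?_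
    by_cases hj : c j = 0
    · rw [hj, zero_smul, TensorProduct.zero_tmul]
      exact Submodule.zero_mem _
    obtain ⟨h1, h2⟩ := (T.isStandard_sub_ind_iff m α j L).1 (hc j hj)
    rw [← TensorProduct.smul_tmul']
    refine Submodule.smul_mem _ _ ?_
    refine ⟨((sgnSet (supp (T.shift α j) \ L) (supp (T.shift α j)) : ℤ) : k) •
      Pi.single j (star k (T.cplxAt m α j) (t + T.offset α j) (supp (T.shift α j) \ L)), ?_⟩
    rw [map_smul, comparison_star T t h2, smul_smul, sgnSet_cast_mul_self, one_smul,
      Finset.sdiff_sdiff_eq_self h1, tensorMono]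

/-- The coordinates of the `e_L`-component of the comparison map in terms of standard
monomials. -/
def coordinates (m : MonomialOrder (Fin n)) (α : Fin n → ℤ) (t : ℤ) (L : Finset (Fin n)) :
    T.Glued m α t →ₗ[k] (Fin s → k) :=
  LinearMap.pi fun j => (Finsupp.linearCombination k fun τ =>
    if supp (T.shift α j) \ τ.1 = L then ((sgnSet τ.1 (supp (T.shift α j)) : ℤ) : k) else 0) ∘ₗ
      LinearMap.proj j

theorem coordinates_single (m : MonomialOrder (Fin n)) (α : Fin n → ℤ) (t : ℤ)
    (L : Finset (Fin n)) (j : Fin s)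
    (τ : {τ : Finset (Fin n) // τ ∈ (T.cplxAt m α j).faces ∧
      (τ.card : ℤ) = t + T.offset α j + 1}) :
    T.coordinates m α t L (Pi.single j (Finsupp.single τ 1)) =
      (if supp (T.shift α j) \ τ.1 = L then ((sgnSet τ.1 (supp (T.shift α j)) : ℤ) : k) else 0) •
        Pi.single j 1 := by
  funext i
  rw [coordinates, LinearMap.pi_apply, LinearMap.comp_apply, LinearMap.proj_apply]
  by_cases h : i = j
  · subst h
    simp
  · simp [h]

theorem isStandard_of_coordinates_ne_zero {m : MonomialOrder (Fin n)} {α : Fin n → ℤ} {t : ℤ}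
    {L : Finset (Fin n)} {x : T.Glued m α t} {j : Fin s} (h : T.coordinates m α t L x j ≠ 0) :
    T.IsStandard m (α - ind L) j := by
  rw [coordinates, LinearMap.pi_apply, LinearMap.comp_apply, Finsupp.linearCombination_apply] at h
  obtain ⟨τ, -, hτ⟩ := Finset.exists_ne_zero_of_sum_ne_zero h
  have hL : supp (T.shift α j) \ τ.1 = L := by
    by_contra hL
    simp [hL] at hτ
  rw [← hL]
  exact T.isStandard_of_mem_cplxAt τ.2.1

theorem coordinates_sdiff (m : MonomialOrder (Fin n)) (α : Fin n → ℤ) (t : ℤ)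
    (x : T.Glued m α t) (j : Fin s)
    (τ : {τ : Finset (Fin n) // τ ∈ (T.cplxAt m α j).faces ∧
      (τ.card : ℤ) = t + T.offset α j + 1}) :
    T.coordinates m α t (supp (T.shift α j) \ τ.1) x j =
      x j τ * ((sgnSet τ.1 (supp (T.shift α j)) : ℤ) : k) := by
  rw [coordinates, LinearMap.pi_apply, LinearMap.comp_apply, Finsupp.linearCombination_apply,
    LinearMap.proj_apply, Finsupp.sum, Finset.sum_eq_single τ]
  · rw [if_pos rfl, smul_eq_mul]
  · intro τ' _ hne
    rw [if_neg, smul_zero]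
    intro h
    apply hne
    have := congrArg (fun σ => supp (T.shift α j) \ σ) h
    simp only [Finset.sdiff_sdiff_eq_self (T.subset_of_mem_cplxAt τ.2.1),
      Finset.sdiff_sdiff_eq_self (T.subset_of_mem_cplxAt τ'.2.1)] at this
    exact Subtype.ext this
  · intro h
    rw [Finsupp.notMem_support_iff.1 h, zero_smul]

theorem finsuppScalarRight_comparison (m : MonomialOrder (Fin n)) (α : Fin n → ℤ) (t : ℤ)
    (L : {L : Finset (Fin n) // (L.card : ℤ) = ((supp (T.shift α 0)).card : ℤ) - t - 1})
    (x : T.Glued m α t) :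
    TensorProduct.finsuppScalarRight (MvPolynomial (Fin n) k) (MvPolynomial (Fin n) k) A.Mod _
      (T.comparison m α t x) L = T.classMap (α - ind L.1) (T.coordinates m α t L.1 x) := by
  let F : T.Glued m α t →ₗ[k] A.Mod :=
    ((Finsupp.lapply L ∘ₗ (TensorProduct.finsuppScalarRight (MvPolynomial (Fin n) k)
      (MvPolynomial (Fin n) k) A.Mod _).toLinearMap).restrictScalars k) ∘ₗ T.comparison m α t
  suffices F = T.classMap (α - ind L.1) ∘ₗ T.coordinates m α t L.1 from LinearMap.congr_fun this x
  refine T.glued_hom_ext fun j τ => ?_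
  have hcard := (T.card_sdiff_eq_iff (t := t) (T.subset_of_mem_cplxAt τ.2.1)).2 τ.2.2
  simp only [F, LinearMap.comp_apply]
  rw [comparison_single, coordinates_single, map_smul, map_smul, classMap_single, tensorMono,
    koszulBasis_of_card hcard]
  simp only [LinearMap.restrictScalars_apply, LinearMap.comp_apply, LinearEquiv.coe_coe,
    Finsupp.lapply_apply, TensorProduct.finsuppScalarRight_apply_tmul_apply]
  by_cases h : supp (T.shift α j) \ τ.1 = L.1
  · have : (⟨supp (T.shift α j) \ τ.1, hcard⟩ : {L : Finset (Fin n) //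
        (L.card : ℤ) = ((supp (T.shift α 0)).card : ℤ) - t - 1}) = L := Subtype.ext h
    rw [if_pos h, this, Finsupp.single_eq_same, one_smul, h]
  · rw [if_neg h, Finsupp.single_eq_of_ne, zero_smul, zero_smul, smul_zero]
    rintro rfl
    exact h rfl

theorem comparison_injective (m : MonomialOrder (Fin n)) (α : Fin n → ℤ) (t : ℤ) :
    Function.Injective (T.comparison m α t) := by
  rw [injective_iff_map_eq_zero]
  intro x hx
  funext j
  ext τ
  have hcard := (T.card_sdiff_eq_iff (t := t) (T.subset_of_mem_cplxAt τ.2.1)).2 τ.2.2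
  -- The coefficient of `τ^*` in `x j` is read off from the `e_L`-component, `L = supp α_j \ τ`.
  have h := T.finsuppScalarRight_comparison m α t ⟨_, hcard⟩ x
  rw [hx, map_zero, Finsupp.zero_apply, ← map_zero (T.classMap _)] at h
  have h0 : 0 = T.coordinates m α t (supp (T.shift α j) \ τ.1) x :=
    T.eq_of_classMap_eq m (fun j hj => absurd rfl hj)
    (fun j hj => T.isStandard_of_coordinates_ne_zero hj) h
  have h1 := T.coordinates_sdiff m α t x j τ
  rw [← h0, Pi.zero_apply] at h1
  simpa [sgnSet_cast_ne_zero] using h1.symm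

/-! ### Compatibility with the differentials -/

/-- Outside `Δ_{j,α}` the monomial is rewritten by its expansion in standard monomials. -/
theorem tensorMono_eq_sum (m : MonomialOrder (Fin n)) (α : Fin n → ℤ) (t : ℤ) {j : Fin s}
    {ρ : Finset (Fin n)} (h0 : 0 ≤ T.shift α j) (hρ : ρ ⊆ supp (T.shift α j))
    (hface : ρ ∉ (T.cplxAt m α j).faces) :
    T.tensorMono α (((supp (T.shift α 0)).card : ℤ) - t - 1) j (supp (T.shift α j) \ ρ) =
      ∑ i ∈ Finset.univ.filter (fun i => i < j),
        (T.r m j i (ind ρ + T.shift α j - ind (supp (T.shift α j))) /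
          ((sgnSet (T.transfer α ρ j i) (supp (T.shift α i)) : ℤ) : k)) •
        T.comparison m α t (Pi.single i
          (star k (T.cplxAt m α i) (t + T.offset α i) (T.transfer α ρ j i))) := by
  set L := supp (T.shift α j) \ ρ with hLdef
  have hL : L ⊆ supp (T.shift α j) := Finset.sdiff_subset
  -- The exponent at which the coefficients are taken is that of the monomial in question.
  have hexp : ind ρ + T.shift α j - ind (supp (T.shift α j)) = α - ind L - T.β j := by
    have : ind ρ + ind L = ind (supp (T.shift α j)) := by
      funext c
      have := @hρ c
      by_cases h1 : c ∈ ρ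
      · simp [ind, hLdef, h1, this h1]
      · by_cases h2 : c ∈ supp (T.shift α j) <;> simp [ind, hLdef, h1, h2]
    rw [← this, shift]
    abel
  have hnn : 0 ≤ α - ind L - T.β j := by
    rw [sub_right_comm]
    exact sub_ind_nonneg_iff.2 ⟨h0, hL⟩
  have hns : supp (α - ind L - T.β j) ∉ (A.cplx m j).faces := by
    intro h
    have := ((T.isStandard_sub_ind_iff m α j L).1 ⟨hnn, h⟩).2
    rw [hLdef, Finset.sdiff_sdiff_eq_self hρ] at this
    exact hface this
  obtain ⟨h1, h2⟩ := T.isExpansion_r m j _ hnn hns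
  rw [hexp, tensorMono, h2, TensorProduct.sum_tmul]
  refine Finset.sum_congr rfl fun i _ => ?_
  by_cases hr : T.r m j i (α - ind L - T.β j) = 0
  · simp [hr]
  have hst : T.IsStandard m (α - ind L) i := by
    have := (h1 i hr).2
    rwa [sub_add_cancel] at this
  obtain ⟨h3, h4⟩ := (T.isStandard_sub_ind_iff m α i L).1 hst
  have htr : T.transfer α ρ j i = supp (T.shift α i) \ L := rfl
  rw [htr, comparison_star T t h4, smul_smul, div_mul_cancel₀ _ (sgnSet_cast_ne_zero k _ _),
    Finset.sdiff_sdiff_eq_self h3, sub_add_cancel, tensorMono, TensorProduct.smul_tmul']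

theorem delta_single (m : MonomialOrder (Fin n)) (α : Fin n → ℤ) (t : ℤ) (j : Fin s)
    (y : Cochain k (T.cplxAt m α j) (t + T.offset α j)) :
    T.delta m α t (Pi.single j y) =
      Pi.single j (coboundary k (T.cplxAt m α j) (t + T.offset α j) (t + 1 + T.offset α j) y) +
        T.chi m α t j y := by
  rw [delta, sum_comp_proj_single]
  rfl

theorem comparison_delta (m : MonomialOrder (Fin n)) (α : Fin n → ℤ) (t : ℤ)
    (x : T.Glued m α t) :
    T.comparison m α (t + 1) (T.delta m α t x) =
      LinearMap.lTensor A.Mod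
        (koszulDiff k n (((supp (T.shift α 0)).card : ℤ) - t - 1)
          (((supp (T.shift α 0)).card : ℤ) - (t + 1) - 1))
        (T.comparison m α t x) := by
  classical
  suffices h : T.comparison m α (t + 1) ∘ₗ T.delta m α t =
      ((LinearMap.lTensor A.Mod
        (koszulDiff k n (((supp (T.shift α 0)).card : ℤ) - t - 1)
          (((supp (T.shift α 0)).card : ℤ) - (t + 1) - 1))).restrictScalars k) ∘ₗ
        T.comparison m α t from LinearMap.congr_fun h x
  refine T.glued_hom_ext fun j τ => ?_
  obtain ⟨τ, hτ, hcard⟩ := τ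
  have hsub := T.subset_of_mem_cplxAt hτ
  have hL := (T.card_sdiff_eq_iff (t := t) hsub).2 hcard
  simp only [LinearMap.comp_apply, LinearMap.restrictScalars_apply]
  rw [comparison_single, LinearMap.map_smul_of_tower,
    T.lTensor_koszulDiff_tensorMono hL (T.isStandard_of_mem_cplxAt hτ).1, delta_single, map_add,
    ← Finset.sum_filter_add_sum_filter_not (supp (T.shift α j) \ τ)
      (fun w => insert w τ ∈ (T.cplxAt m α j).faces), smul_add]
  have hsign : ∀ w ∈ supp (T.shift α j) \ τ,
      ((sgn w (insert w τ) : ℤ) : k) * ((sgnSet (insert w τ) (supp (T.shift α j)) : ℤ) : k) =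
        ((sgnSet τ (supp (T.shift α j)) : ℤ) : k) *
          ((sgn w (supp (T.shift α j) \ τ) : ℤ) : k) := by
    intro w hw
    rw [← Int.cast_mul, ← Int.cast_mul,
      sgn_insert_mul_sgnSet_insert hsub (Finset.mem_sdiff.1 hw).2]
  -- The terms with `τ w` a face give `d_j`, the other ones `χ_j`.
  congr 1
  · rw [coboundary, Finsupp.linearCombination_single, one_smul, Finset.smul_sum]
    have hfilter : (Finset.univ.filter
        (fun w => w ∉ τ ∧ insert w τ ∈ (T.cplxAt m α j).faces)) =
        (supp (T.shift α j) \ τ).filter fun w => insert w τ ∈ (T.cplxAt m α j).faces := by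
      ext w
      simp only [Finset.mem_filter, Finset.mem_univ, true_and, Finset.mem_sdiff]
      exact ⟨fun h => ⟨⟨T.subset_of_mem_cplxAt h.2 (Finset.mem_insert_self _ _), h.1⟩, h.2⟩,
        fun h => ⟨h.1.2, h.2⟩⟩
    have hsingle : ∀ y, (Pi.single j y : T.Glued m α (t + 1)) =
        LinearMap.single k (fun i => Cochain k (T.cplxAt m α i) (t + 1 + T.offset α i)) j y :=
      fun _ => rfl
    rw [hsingle, map_sum, map_sum]
    refine Finset.sum_congr (by convert hfilter) fun w hw => ?_
    rw [Finset.mem_filter] at hw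
    rw [map_smul, map_smul, ← hsingle, T.comparison_star (t + 1) hw.2, smul_smul, smul_smul,
      hsign w hw.1, Finset.sdiff_insert]
  · rw [chi, Finsupp.linearCombination_single, one_smul, Finset.smul_sum, map_sum]
    refine Finset.sum_congr (by congr) fun w hw => ?_
    rw [Finset.mem_filter] at hw
    have hw' := Finset.mem_sdiff.1 hw.1
    rw [smul_smul, ← hsign w hw.1, ← Finset.sdiff_insert,
      T.tensorMono_eq_sum m α (t + 1) hτ.1 (Finset.insert_subset hw'.1 hsub) hw.2, map_sum,
      Finset.smul_sum]
    refine Finset.sum_congr rfl fun i _ => ?_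
    rw [map_smul, smul_smul]
    congr 1
    ring

theorem delta_comp_delta (m : MonomialOrder (Fin n)) (α : Fin n → ℤ) (t : ℤ) :
    T.delta m α (t + 1) ∘ₗ T.delta m α t = 0 := by
  refine LinearMap.ext fun x => T.comparison_injective m α (t + 1 + 1) ?_
  rw [LinearMap.comp_apply, comparison_delta, comparison_delta, ← LinearMap.comp_apply,
    ← LinearMap.lTensor_comp, koszulDiff_comp_koszulDiff _ (by ring), LinearMap.lTensor_zero,
    LinearMap.zero_apply, LinearMap.zero_apply, map_zero]

end SquarefreeSolution

end MonomialMatrix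

end SquarefreeModule

end

theorem mainTheorem4 {k : Type*} [Field k] {n s l : ℕ} [NeZero s]
    (A : MonomialMatrix k n s l) (hA : A.IsSquarefree) (T : A.SquarefreeSolution)
    (m : MonomialOrder (Fin n)) (α : Fin n → ℤ) :
    -- the coefficients `r_{i,j,a}` exist and are unique
    (∀ (i : Fin s) (a : Fin n → ℤ), 0 ≤ a → supp a ∉ (A.cplx m i).faces →
      ∃! c : Fin s → k, T.IsExpansion m i a c) ∧
    -- `C^•(A,α)` is a cochain complex
    (∀ t : ℤ, T.delta m α (t + 1) ∘ₗ T.delta m α t = 0) ∧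
    -- `C^t(A,α)` is identified with the piece of degree `α` of `M_A ⊗ K_{|supp α_1| - t - 1}`,
    -- compatibly with the differentials
    ∃ e : ∀ t : ℤ, T.Glued m α t ≃ₗ[k]
        T.tensorPiece α (((supp (T.shift α 0)).card : ℤ) - t - 1),
      ∀ (t : ℤ) (x : T.Glued m α t),
        (e (t + 1) (T.delta m α t x) :
            A.Mod ⊗[MvPolynomial (Fin n) k]
              Koszul k n (((supp (T.shift α 0)).card : ℤ) - (t + 1) - 1)) =
          LinearMap.lTensor A.Mod
            (koszulDiff k n (((supp (T.shift α 0)).card : ℤ) - t - 1)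
              (((supp (T.shift α 0)).card : ℤ) - (t + 1) - 1))
            (e t x) := by
  refine ⟨T.existsUnique_isExpansion m, T.delta_comp_delta m α, fun t =>
    (LinearEquiv.ofInjective _ (T.comparison_injective m α t)).trans
      (LinearEquiv.ofEq _ _ (T.range_comparison m α t)), fun t x => ?_⟩
  exact T.comparison_delta m α t x
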